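/- Conventions. All graphs are finite. A DAG is a directed graph without directed cycles; two DAGs on the same vertex set are Markov equivalent if they encode the same conditional independencies (have the same d-separations). The essential graph of a DAG $D$ has the same skeleton as $D$, and an edge is directed in it if and only if the edge has the same orientation in every DAG that is Markov equivalent to $D$. For an undirected chordal graph $\mathcal K$ (every cycle with at least four vertices has a chord; $\mathcal K$ may be disconnected or empty), $\mathrm{Size}(\mathcal K)$ is the number of DAGs in the Markov equivalence class represented by $\mathcal K$, i.e. the number of DAGs whose essential graph is $\mathcal K$; for a vertex $v$, $\mathrm{Size}(\mathcal K^{(v)})$ is the number of those DAGs in which no edge points into $v$; $\mathcal K_{N_v}$ is the subgraph of $\mathcal K$ induced on the neighbors of $v$; $\mathcal K^{m+}$ is the graph obtained from $\mathcal K$ by adding $m$ vertices, each adjacent to all other vertices; and $f(\mathcal K,m)=\mathrm{Size}(\mathcal K^{m+})$. Theorem 2. Let $\mathcal K$ be an undirected chordal graph with vertex set $V$. Then $$g(\mathcal K,m):=\frac1{m!}\sum_{v\in V} f(\mathcal K_{N_v},m)\,\frac{\mathrm{Size}(\mathcal K^{(v)})}{\mathrm{Size}(\mathcal K_{N_v})}$$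 is, as a function of the integer $m\ge 0$, given by a polynomial in $m$ with rational coefficients; write it as $g(\mathcal K,m)=\sum_{i=1}^{d+1}\gamma_i m^{i-1}$, where $d$ is its degree ($d=0$ and $\gamma_1=0$ if it is the zero polynomial). Let $a_{ij}=(-1)^{j-i}\binom{j}{i-1}$ for $1\le i\le j$. Then for every integer $m\ge 0$, $$f(\mathcal K,m)=\Bigl(\beta_0+\sum_{i=1}^{d+1}\beta_i m^i\Bigr)\,m!,$$ where $\beta_0=\mathrm{Size}(\mathcal K)$, $\beta_{d+1}=\gamma_{d+1}/a_{d+1,d+1}$, and, for $i=d,d-1,\dots,1$, $\beta_i=\bigl(\gamma_i-\sum_{j=i+1}^{d+1}a_{ij}\beta_j\bigr)/a_{ii}$. -/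

import Mathlib

/-- A directed acyclic graph on the vertex set `V`: a digraph without directed cycles
(in particular without loops and without pairs of opposite arrows). -/
structure DAG (V : Type*) extends Digraph V where
  acyclic : ∀ v, ¬ Relation.TransGen Adj v v

namespace DAG

variable {V : Type*}

/-- The skeleton: the undirected graph obtained by forgetting the directions. -/
def skeleton (D : DAG V) : SimpleGraph V := D.toDigraph.toSimpleGraphInclusive

/-- The smallest ancestral set containing `X`: all vertices with a (possibly trivial) directed
path to a vertex of `X`. -/
def ancestors (D : DAG V) (X : Set V) : Set V :=
  {u | ∃ w ∈ X, Relation.ReflTransGen D.Adj u w}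

/-- The moral graph of the subgraph of `D` induced on `T`: two distinct vertices of `T` are joined
if they are joined by an arrow or have a common child in `T`. Vertices outside `T` are isolated. -/
def moralGraph (D : DAG V) (T : Set V) : SimpleGraph V :=
  SimpleGraph.fromRel fun u v =>
    u ∈ T ∧ v ∈ T ∧ (D.Adj u v ∨ ∃ w ∈ T, D.Adj u w ∧ D.Adj v w)

/-- `D` encodes the conditional independence of `A` and `B` given `S` (directed global Markov
property, that is, d-separation): in the moral graph of the smallest ancestral set containing
`A ∪ B ∪ S`, every walk from `A` to `B` meets `S`. -/
def EncodesIndep (D : DAG V) (A B S : Set V) : Prop :=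
  ∀ a ∈ A, ∀ b ∈ B, ∀ p : (D.moralGraph (D.ancestors (A ∪ B ∪ S))).Walk a b,
    ∃ s ∈ S, s ∈ p.support

/-- Two DAGs are Markov equivalent if they encode the same set of conditional independencies. -/
def MarkovEquiv (D D' : DAG V) : Prop :=
  ∀ A B S : Set V, Disjoint A B → Disjoint A S → Disjoint B S →
    (D.EncodesIndep A B S ↔ D'.EncodesIndep A B S)

/-- `v` is a root of `D`: all arrows at `v` point out of `v`. -/
def IsRoot (D : DAG V) (v : V) : Prop := ∀ u, ¬ D.Adj u v

end DAG

/-- A graph that may have both directed and undirected edges. -/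
structure MixedGraph (V : Type*) where
  /-- the undirected edges `u - v` -/
  line : V → V → Prop
  /-- the directed edges `u → v` -/
  arrow : V → V → Prop

/-- An undirected graph, seen as a mixed graph without directed edges. -/
def SimpleGraph.toMixedGraph {V : Type*} (K : SimpleGraph V) : MixedGraph V where
  line := K.Adj
  arrow _ _ := False

namespace DAG

variable {V : Type*}

/-- The edge `u → v` occurs in every DAG that is Markov equivalent to `D`. -/
def Compelled (D : DAG V) (u v : V) : Prop := ∀ D' : DAG V, D.MarkovEquiv D' → D'.Adj u v

/-- The essential graph of (the Markov equivalence class of) `D`: it has the skeleton of `D`, and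
an edge is directed if and only if it has the same orientation in every equivalent DAG. -/
def essentialGraph (D : DAG V) : MixedGraph V where
  line u v := D.skeleton.Adj u v ∧ ¬ D.Compelled u v ∧ ¬ D.Compelled v u
  arrow u v := D.skeleton.Adj u v ∧ D.Compelled u v

end DAG

namespace MixedGraph

variable {V : Type*}

/-- The Markov equivalence class represented by the mixed graph `C`. -/
def markovClass (C : MixedGraph V) : Set (DAG V) := {D | D.essentialGraph = C}

/-- `Size(C)`: the number of DAGs in the Markov equivalence class represented by `C`. -/
noncomputable def size (C : MixedGraph V) : ℕ := Nat.card C.markovClass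

end MixedGraph

namespace SimpleGraph

variable {V : Type*}

/-- Every cycle with four or more vertices has a chord. -/
def IsChordal (K : SimpleGraph V) : Prop :=
  ∀ (v : V) (p : K.Walk v v), p.IsCycle → 4 ≤ p.length → ∃ e, p.IsChord e

/-- `Size(K)`: the size of the Markov equivalence class represented by the undirected graph `K`. -/
noncomputable def size (K : SimpleGraph V) : ℕ := K.toMixedGraph.size

/-- `Size(K^(v))`: the size of the `v`-rooted sub-class of `K`, the set of all DAGs in the Markov
equivalence class represented by `K` that have `v` as a root. -/
noncomputable def rootedSize (K : SimpleGraph V) (v : V) : ℕ :=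
  Nat.card {D : DAG V // D ∈ K.toMixedGraph.markovClass ∧ D.IsRoot v}

/-- `K^{m+}`: the graph obtained from `K` by adding `m` dominating vertices. -/
def extended (K : SimpleGraph V) (m : ℕ) : SimpleGraph (V ⊕ Fin m) :=
  (K ⊕g (⊤ : SimpleGraph (Fin m))) ⊔ completeBipartiteGraph V (Fin m)

/-- `f(K, m) = Size(K^{m+})`. -/
noncomputable def sizeExtended (K : SimpleGraph V) (m : ℕ) : ℕ := (K.extended m).size

/-- `K_{N_v}`: the subgraph of `K` induced on the neighbors of `v`. -/
def nbrGraph (K : SimpleGraph V) (v : V) : SimpleGraph (K.neighborSet v) :=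
  K.induce (K.neighborSet v)

/-- `g(K, m) = (1 / m!) * ∑ v, f(K_{N_v}, m) * Size(K^(v)) / Size(K_{N_v})`. -/
noncomputable def sizeIncrement [Fintype V] (K : SimpleGraph V) (m : ℕ) : ℚ :=
  (1 / (m.factorial : ℚ)) * ∑ v : V, ((K.nbrGraph v).sizeExtended m : ℚ) *
    ((K.rootedSize v : ℚ) / ((K.nbrGraph v).size : ℚ))

end SimpleGraph

/-- The entries `a_{ij} = (-1)^(j-i) * (j choose i-1)`, for `1 ≤ i ≤ j`, of the upper triangular
system. -/
def coeffA (i j : ℕ) : ℚ := (-1) ^ (j - i) * (j.choose (i - 1) : ℚ)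

/-! Chordality enters only through vertex rankings: `IsChordal.isRootable` puts any prescribed
vertex first and makes the earlier neighbors of every vertex a clique. By
`DAG.mem_markovClass_toMixedGraph_iff` the class represented by K then consists of the acyclic
orientations of K in which any two parents of a vertex are adjacent: for these, d-separation is
plain separation in K, and orientations with prescribed root show that no edge is compelled.

Such orientations are counted by their roots. If v is a root, an arrow into a neighbor of v starts
at v or at another neighbor, so the count is the count for K_{N_v} times an outer count
(`rootedCount_eq_mul`). The outer count equals Size(K^(v)) / Size(K_{N_v}) and does not change when
dominating vertices are added (`outerCount_extended`). A graph with a dominating vertex has exactly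
one root per orientation, and summing over the possible roots of K^{(m+1)+} gives f(K, m+1) = ∑ v,
f(K_{N_v}, m+1) * outer(v) + (m+1) * f(K, m).

Division by (m+1)! turns this into h(m+1) - h(m) = g(K, m+1) for h(m) = f(K, m) / m!, with h(0) =
Size(K). Neighborhoods have fewer vertices than K, so by induction g, and with it h, is a
polynomial. Comparing coefficients in Q(m) - Q(m-1) = g(K, m), where Q = h - h(0), yields the
triangular system with entries a_{ij}, solved from the top degree downwards. -/

namespace SimpleGraph

variable {V : Type*}

/-! ### Simplicial vertices of chordal graphs. -/

/-- A chord between two vertices of a walk that are not consecutive on it shortens the walk. -/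
lemma Walk.exists_shortcut {G : SimpleGraph V} {x y : V} (p : G.Walk x y) {i j : ℕ} (hij : i < j)
    (hj : j ≤ p.length) (h : G.Adj (p.getVert i) (p.getVert j))
    (he : s(p.getVert i, p.getVert j) ∉ p.edges) :
    ∃ q : G.Walk x y, q.length < p.length ∧ q.support ⊆ p.support := by
  refine ⟨(p.take i).append (Walk.cons h (p.drop j)), ?_, ?_⟩
  · have hne : j ≠ i + 1 := by
      rintro rfl
      have := p.toSubgraph_adj_getVert (i := i) (by omega)
      rw [← Subgraph.mem_edgeSet, Walk.mem_edges_toSubgraph] at this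
      exact he this
    simp only [Walk.length_append, Walk.length_cons, Walk.take_length, Walk.drop_length]
    omega
  · intro w hw
    rw [Walk.mem_support_append_iff, Walk.support_cons, List.mem_cons] at hw
    rcases hw with hw | rfl | hw
    · exact (p.isSubwalk_take i).support_subset hw
    · exact p.getVert_mem_support i
    · exact (p.isSubwalk_drop j).support_subset hw

/-- In a chordal graph, two neighbors of `v` that are joined by a walk avoiding `v` and all its
other neighbors are adjacent. -/
lemma IsChordal.adj_of_walk {K : SimpleGraph V} (hK : K.IsChordal) {v x y : V}
    (hx : K.Adj v x) (hy : K.Adj v y) (hxy : x ≠ y) (q : K.Walk x y)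
    (hq : ∀ w ∈ q.support, w = x ∨ w = y ∨ (w ≠ v ∧ ¬ K.Adj v w)) : K.Adj x y := by
  classical
  by_contra hn
  -- A shortest such walk, made into a path, closes up through `v` to a cycle of length at least
  -- four. A chord at `v` is excluded by `hq`, and any other chord would shorten the path.
  obtain ⟨p₀, hp₀, hmin₀⟩ := WellFounded.has_min (measure fun p : K.Walk x y => p.length).wf
    {p | ∀ w ∈ p.support, w = x ∨ w = y ∨ (w ≠ v ∧ ¬ K.Adj v w)} ⟨q, hq⟩
  have hp : ∀ w ∈ p₀.bypass.support, w = x ∨ w = y ∨ (w ≠ v ∧ ¬ K.Adj v w) :=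
    fun w hw => hp₀ w (p₀.support_bypass_subset_support hw)
  have hmin : ∀ p' : K.Walk x y, p'.support ⊆ p₀.bypass.support →
      p₀.bypass.length ≤ p'.length := by
    intro p' hp'
    have := hmin₀ p' (fun w hw => hp w (hp' hw))
    have h2 := p₀.length_bypass_le_length
    simp only [InvImage, WellFoundedRelation.rel, not_lt] at this
    omega
  have hpath := p₀.bypass_isPath
  generalize p₀.bypass = p at hp hmin hpath
  have hv : v ∉ p.support := by
    intro h
    rcases hp v h with h | h | h
    · exact hx.ne h
    · exact hy.ne h
    · exact h.1 rfl
  have hcyc : (Walk.cons hx (p.concat hy.symm)).IsCycle := by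
    rw [Walk.cons_isCycle_iff]
    refine ⟨hpath.concat hv _, ?_⟩
    rw [Walk.edges_concat, List.concat_eq_append, List.mem_append, not_or]
    refine ⟨fun h => hv (Walk.fst_mem_support_of_mem_edges _ h), ?_⟩
    simp [hxy, hy.ne]
  have hlen : 2 ≤ p.length := by
    by_contra h
    have : p.length = 0 ∨ p.length = 1 := by omega
    rcases this with h | h
    · exact hxy (Walk.eq_of_length_eq_zero h)
    · exact hn (Walk.adj_of_length_eq_one h)
  obtain ⟨e, he⟩ := hK v _ hcyc (by simp; omega)
  induction e using Sym2.ind with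
  | _ a b =>
  rw [Walk.isChord_sym2Mk] at he
  obtain ⟨hab, hed, ha, hb⟩ := he
  have hvert : ∀ b ∈ p.support, K.Adj v b → b = x ∨ b = y := fun b hb h => by
    rcases hp b hb with h' | h' | h'
    · exact Or.inl h'
    · exact Or.inr h'
    · exact absurd h h'.2
  have hedge : ∀ b ∈ p.support, K.Adj v b →
      s(v, b) ∈ (Walk.cons hx (p.concat hy.symm)).edges := fun b hb h => by
    rcases hvert b hb h with rfl | rfl
    · simp
    · simp [Walk.edges_concat, Sym2.eq_swap]
  have hsupp : ∀ a ∈ (Walk.cons hx (p.concat hy.symm)).support, a = v ∨ a ∈ p.support := by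
    intro a ha
    simp only [Walk.support_cons, Walk.support_concat, List.mem_cons,
      List.mem_append, List.not_mem_nil, or_false] at ha
    tauto
  rcases hsupp a ha with rfl | ha'
  · rcases hsupp b hb with rfl | hb'
    · exact hab.ne rfl
    · exact hed (hedge b hb' hab)
  rcases hsupp b hb with rfl | hb'
  · exact hed (Sym2.eq_swap ▸ hedge a ha' hab.symm)
  have hed' : s(a, b) ∉ p.edges := fun h => hed (by simp [Walk.edges_concat, h])
  obtain ⟨i, rfl, hi⟩ := Walk.mem_support_iff_exists_getVert.1 ha'
  obtain ⟨j, rfl, hj⟩ := Walk.mem_support_iff_exists_getVert.1 hb'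
  have : ∃ q : K.Walk x y, q.length < p.length ∧ q.support ⊆ p.support := by
    rcases lt_trichotomy i j with h | rfl | h
    · exact p.exists_shortcut h hj hab hed'
    · exact absurd rfl hab.ne
    · exact p.exists_shortcut h hi hab.symm (Sym2.eq_swap ▸ hed')
  obtain ⟨q, hq1, hq2⟩ := this
  exact absurd (hmin q hq2) (not_le.2 hq1)

/-- Dirac: in an induced subgraph of a chordal graph, a vertex that is not dominating has a
simplicial non-neighbor. -/
lemma IsChordal.exists_simplicial_not_adj {K : SimpleGraph V} (hK : K.IsChordal) (U : Finset V) :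
    ∀ v ∈ U, (∃ x ∈ U, x ≠ v ∧ ¬ K.Adj v x) → ∃ w ∈ U, w ≠ v ∧ ¬ K.Adj v w ∧
      ∀ a ∈ U, ∀ b ∈ U, K.Adj a w → K.Adj b w → a ≠ b → K.Adj a b := by
  classical
  induction U using Finset.strongInduction with
  | H U ih =>
  rintro v hv ⟨x₀, hx₀, hx₀v, hx₀a⟩
  -- `F` collects the non-neighbors of `v`, `C` is the component of `x₀` in `F`, and `A` below is
  -- the set of neighbors of `v` attached to `C`. `A` is a clique, since two of its members are
  -- joined through `C`. The induction runs on `C ∪ A`, which misses `v`.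
  let F : V → Prop := fun x => x ∈ U ∧ x ≠ v ∧ ¬ K.Adj v x
  let C : V → Prop := Relation.ReflTransGen (fun a b => K.Adj a b ∧ F b) x₀
  have hCx₀ : C x₀ := .refl
  have hCF : ∀ c, C c → F c := by
    intro c hc
    rcases Relation.ReflTransGen.cases_tail hc with rfl | ⟨d, _, hd⟩
    · exact ⟨hx₀, hx₀v, hx₀a⟩
    · exact hd.2
  have hwalk : ∀ c, C c → ∃ p : K.Walk x₀ c, ∀ w ∈ p.support, F w := by
    intro c hc
    induction hc with
    | refl => exact ⟨.nil, by simpa using hCF x₀ hCx₀⟩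
    | tail _ h ih =>
      obtain ⟨p, hp⟩ := ih
      refine ⟨p.concat h.1, fun w hw => ?_⟩
      simp only [Walk.support_concat, List.mem_append, List.mem_cons,
        List.not_mem_nil, or_false] at hw
      rcases hw with hw | rfl
      · exact hp w hw
      · exact h.2
  let A : V → Prop := fun a => a ∈ U ∧ K.Adj v a ∧ ∃ c, C c ∧ K.Adj a c
  have hclique : ∀ a b, A a → A b → a ≠ b → K.Adj a b := by
    rintro a b ⟨-, hva, c, hc, hac⟩ ⟨-, hvb, d, hd, hbd⟩ hab
    obtain ⟨p, hp⟩ := hwalk c hc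
    obtain ⟨q, hq⟩ := hwalk d hd
    refine hK.adj_of_walk hva hvb hab (.cons hac ((p.reverse.append q).concat hbd.symm)) ?_
    intro w hw
    simp only [Walk.support_cons, Walk.support_concat, List.mem_cons,
      List.mem_append, List.not_mem_nil, or_false, Walk.mem_support_append_iff,
      Walk.support_reverse, List.mem_reverse] at hw
    rcases hw with rfl | (hw | hw) | rfl
    · exact Or.inl rfl
    · exact Or.inr (Or.inr (hp w hw).2)
    · exact Or.inr (Or.inr (hq w hw).2)
    · exact Or.inr (Or.inl rfl)
  have hnbr : ∀ c b, C c → b ∈ U → K.Adj b c → C b ∨ A b := by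
    intro c b hc hb hbc
    by_cases h : K.Adj v b
    · exact Or.inr ⟨hb, h, c, hc, hbc⟩
    · refine Or.inl (hc.tail ⟨hbc.symm, hb, ?_, h⟩)
      rintro rfl
      exact (hCF c hc).2.2 hbc
  let U' : Finset V := U.filter fun x => C x ∨ A x
  have hU' : ∀ x, x ∈ U' ↔ C x ∨ A x := by
    intro x
    simp only [U', Finset.mem_filter, and_iff_right_iff_imp]
    rintro (h | h)
    · exact (hCF x h).1
    · exact h.1
  have hvU' : v ∉ U' := by
    rw [hU']
    rintro (h | h)
    · exact (hCF v h).2.1 rfl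
    · exact h.2.1.ne rfl
  have hss : U' ⊂ U := ⟨Finset.filter_subset _ _, fun h => hvU' (h hv)⟩
  -- Neighbors in `U` of a vertex of `C` stay in `C ∪ A`, so simpliciality there suffices. The cases
  -- below find a simplicial vertex in `C`: it is nonadjacent to some vertex of the clique `A`, or
  -- to some vertex of `C` when `A` is completely joined to `C`, or `C ∪ A` is itself a clique.
  have hlift : ∀ w, C w → (∀ a ∈ U', ∀ b ∈ U', K.Adj a w → K.Adj b w → a ≠ b → K.Adj a b) →
      ∃ w ∈ U, w ≠ v ∧ ¬ K.Adj v w ∧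
      ∀ a ∈ U, ∀ b ∈ U, K.Adj a w → K.Adj b w → a ≠ b → K.Adj a b := by
    intro w hw h
    refine ⟨w, (hCF w hw).1, (hCF w hw).2.1, (hCF w hw).2.2, fun a ha b hb haw hbw => ?_⟩
    exact h a ((hU' a).2 (hnbr w a hw ha haw)) b ((hU' b).2 (hnbr w b hw hb hbw)) haw hbw
  by_cases h1 : ∃ a c, A a ∧ C c ∧ ¬ K.Adj a c
  · obtain ⟨a, c, ha, hc, hac⟩ := h1
    have hca : c ≠ a := by
      rintro rfl
      exact (hCF c hc).2.2 ha.2.1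
    obtain ⟨w, hw, hwa, hnw, hs⟩ := ih U' hss a ((hU' a).2 (.inr ha))
      ⟨c, (hU' c).2 (.inl hc), hca, hac⟩
    rcases (hU' w).1 hw with h | h
    · exact hlift w h hs
    · exact absurd (hclique a w ha h hwa.symm) hnw
  push Not at h1
  by_cases h2 : ∃ c d, C c ∧ C d ∧ c ≠ d ∧ ¬ K.Adj c d
  · obtain ⟨c, d, hc, hd, hcd, hn⟩ := h2
    obtain ⟨w, hw, hwa, hnw, hs⟩ := ih U' hss c ((hU' c).2 (.inl hc))
      ⟨d, (hU' d).2 (.inl hd), hcd.symm, hn⟩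
    rcases (hU' w).1 hw with h | h
    · exact hlift w h hs
    · exact absurd (h1 w c h hc).symm hnw
  push Not at h2
  refine hlift x₀ hCx₀ fun a ha b hb _ _ hab => ?_
  rcases (hU' a).1 ha with ha | ha <;> rcases (hU' b).1 hb with hb | hb
  · exact h2 a b ha hb hab
  · exact (h1 b a hb ha).symm
  · exact h1 a b ha hb
  · exact hclique a b ha hb hab

/-- An induced subgraph of a chordal graph with at least two vertices has a simplicial vertex
other than a given vertex. -/
lemma IsChordal.exists_simplicial_ne {K : SimpleGraph V} (hK : K.IsChordal) (U : Finset V)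
    {v x : V} (hv : v ∈ U) (hx : x ∈ U) (hxv : x ≠ v) : ∃ w ∈ U, w ≠ v ∧
      ∀ a ∈ U, ∀ b ∈ U, K.Adj a w → K.Adj b w → a ≠ b → K.Adj a b := by
  by_cases h : ∃ x ∈ U, x ≠ v ∧ ¬ K.Adj v x
  · obtain ⟨w, hw, hwv, -, hs⟩ := hK.exists_simplicial_not_adj U v hv h
    exact ⟨w, hw, hwv, hs⟩
  push Not at h
  by_cases h2 : ∃ c ∈ U, ∃ d ∈ U, d ≠ c ∧ ¬ K.Adj c d
  · obtain ⟨c, hc, d, hd, hdc, hn⟩ := h2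
    obtain ⟨w, hw, hwc, hnw, hs⟩ := hK.exists_simplicial_not_adj U c hc ⟨d, hd, hdc, hn⟩
    refine ⟨w, hw, ?_, hs⟩
    rintro rfl
    exact hnw (h c hc hwc.symm).symm
  · push Not at h2
    exact ⟨x, hx, hxv, fun a ha b hb _ _ hab => h2 a ha b hb hab.symm⟩

/-! ### Rankings with a prescribed first vertex. -/

/-- For each vertex `v`, the vertices can be ranked such that `v` comes first and the adjacent
predecessors of every vertex form a clique. -/
def IsRootable (K : SimpleGraph V) : Prop :=
  ∀ v, ∃ f : V → ℕ, Function.Injective f ∧ (∀ x, x ≠ v → f v < f x) ∧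
    ∀ a b c, K.Adj a c → K.Adj b c → f a < f c → f b < f c → a ≠ b → K.Adj a b

/-- A simplicial vertex other than `v` is removed and ranked last. One exists as long as a vertex
other than `v` remains, so `v` ends up first. -/
lemma IsChordal.isRootable [Finite V] {K : SimpleGraph V} (hK : K.IsChordal) : K.IsRootable := by
  classical
  have := Fintype.ofFinite V
  intro v
  suffices H : ∀ U : Finset V, v ∈ U → ∃ f : V → ℕ, Set.InjOn f U ∧
      (∀ x ∈ U, x ≠ v → f v < f x) ∧ ∀ a ∈ U, ∀ b ∈ U, ∀ c ∈ U, K.Adj a c → K.Adj b c →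
      f a < f c → f b < f c → a ≠ b → K.Adj a b by
    obtain ⟨f, h1, h2, h3⟩ := H Finset.univ (Finset.mem_univ v)
    exact ⟨f, fun a b h => h1 (by simp) (by simp) h, fun x => h2 x (by simp),
      fun a b c => h3 a (by simp) b (by simp) c (by simp)⟩
  intro U
  induction U using Finset.strongInduction with
  | H U ih =>
  intro hv
  by_cases hU : ∃ x ∈ U, x ≠ v
  · obtain ⟨x, hx, hxv⟩ := hU
    obtain ⟨w, hw, hwv, hs⟩ := hK.exists_simplicial_ne U hv hx hxv
    obtain ⟨f, h1, h2, h3⟩ := ih (U.erase w) (Finset.erase_ssubset hw)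
      (Finset.mem_erase.2 ⟨hwv.symm, hv⟩)
    let N := U.sup f + 1
    have hN : ∀ x ∈ U, f x < N := fun x hx => Nat.lt_succ_of_le (Finset.le_sup hx)
    have hfw : Function.update f w N w = N := by simp
    have hf : ∀ x, x ≠ w → Function.update f w N x = f x := fun x hx => by simp [hx]
    refine ⟨Function.update f w N, ?_, ?_, ?_⟩
    · intro a ha b hb hab
      by_cases haw : a = w <;> by_cases hbw : b = w
      · rw [haw, hbw]
      · rw [haw, hfw, hf b hbw] at hab
        exact absurd hab (hN b hb).ne'
      · rw [hbw, hfw, hf a haw] at hab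
        exact absurd hab (hN a ha).ne
      · rw [hf a haw, hf b hbw] at hab
        exact h1 (by simp [haw, Finset.mem_coe.1 ha]) (by simp [hbw, Finset.mem_coe.1 hb]) hab
    · intro x hx hxv
      rw [hf v hwv.symm]
      by_cases hxw : x = w
      · rw [hxw, hfw]; exact hN v hv
      · rw [hf x hxw]; exact h2 x (Finset.mem_erase.2 ⟨hxw, hx⟩) hxv
    · intro a ha b hb c hc hac hbc hfa hfb hab
      by_cases hcw : c = w
      · subst hcw; exact hs a ha b hb hac hbc hab
      have hne : ∀ a ∈ U, Function.update f w N a < Function.update f w N c → a ≠ w := by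
        rintro a ha h rfl
        rw [hfw, hf c hcw] at h
        exact absurd h (hN c hc).not_gt
      have haw := hne a ha hfa
      have hbw := hne b hb hfb
      rw [hf a haw, hf c hcw] at hfa
      rw [hf b hbw, hf c hcw] at hfb
      exact h3 a (Finset.mem_erase.2 ⟨haw, ha⟩) b (Finset.mem_erase.2 ⟨hbw, hb⟩) c
        (Finset.mem_erase.2 ⟨hcw, hc⟩) hac hbc hfa hfb hab
  · push Not at hU
    refine ⟨fun _ => 0, ?_, ?_, ?_⟩
    · intro a ha b hb _
      rw [hU a ha, hU b hb]
    · intro x hx hxv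
      exact absurd (hU x hx) hxv
    · intro a _ b _ c _ _ _ h
      exact absurd h (lt_irrefl _)

lemma IsRootable.nbrGraph {K : SimpleGraph V} (hK : K.IsRootable) (v : V) :
    (K.nbrGraph v).IsRootable := by
  intro u
  obtain ⟨f, h1, h2, h3⟩ := hK u
  refine ⟨fun x => f x, h1.comp Subtype.val_injective,
    fun x hx => h2 x (fun h => hx (Subtype.ext h)), fun a b c hac hbc ha hb hab => ?_⟩
  exact h3 a b c hac hbc ha hb (fun h => hab (Subtype.ext h))

section extended

variable (K : SimpleGraph V) (m : ℕ)

@[simp] lemma extended_adj_inl_inl (x y : V) :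
    (K.extended m).Adj (.inl x) (.inl y) ↔ K.Adj x y := by
  simp [extended]

@[simp] lemma extended_adj_inl_inr (x : V) (i : Fin m) :
    (K.extended m).Adj (.inl x) (.inr i) := by
  simp [extended]

@[simp] lemma extended_adj_inr_inl (x : V) (i : Fin m) :
    (K.extended m).Adj (.inr i) (.inl x) := by
  simp [extended]

@[simp] lemma extended_adj_inr_inr (i j : Fin m) :
    (K.extended m).Adj (.inr i) (.inr j) ↔ i ≠ j := by
  simp [extended]

end extended

lemma extended_adj_inr (K : SimpleGraph V) {m : ℕ} (i : Fin m) {x : V ⊕ Fin m}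
    (hx : x ≠ .inr i) : (K.extended m).Adj (.inr i) x := by
  rcases x with x | j
  · simp
  · simpa [eq_comm] using hx

/-- Dominating vertices may precede all of `V`, being adjacent to everything, and the prescribed
vertex is then moved to the front. This replaces an analysis of the cycles of the extended graph. -/
lemma IsRootable.extended {K : SimpleGraph V} (hK : K.IsRootable) (m : ℕ) :
    (K.extended m).IsRootable := by
  classical
  have key : ∀ (v : V ⊕ Fin m) (f : V → ℕ),
      Function.Injective f → (∀ x y, v = .inl x → y ≠ x → f x < f y) →
      (∀ a b c, K.Adj a c → K.Adj b c → f a < f c → f b < f c → a ≠ b → K.Adj a b) →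
      ∃ f : V ⊕ Fin m → ℕ, Function.Injective f ∧ (∀ x, x ≠ v → f v < f x) ∧
        ∀ a b c, (K.extended m).Adj a c → (K.extended m).Adj b c → f a < f c → f b < f c →
          a ≠ b → (K.extended m).Adj a b := by
    intro v f h1 h2 h3
    -- The `+ 1` keeps rank 0 free for `v`.
    let g : V ⊕ Fin m → ℕ := Sum.elim (fun x => f x + m + 1) (fun i => i + 1)
    have hg : Function.Injective g := by
      rintro (x | i) (y | j) h
      · simp only [g, Sum.elim_inl] at h
        rw [h1 (a₁ := x) (a₂ := y) (by omega)]
      · simp only [g, Sum.elim_inl, Sum.elim_inr] at h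
        omega
      · simp only [g, Sum.elim_inl, Sum.elim_inr] at h
        omega
      · simp only [g, Sum.elim_inr] at h
        rw [Fin.ext (a := i) (b := j) (by omega)]
    have hg0 : ∀ x, 0 < g x := by rintro (x | i) <;> simp [g]
    have hv : Function.update g v 0 v = 0 := by simp
    have hne : ∀ x, x ≠ v → Function.update g v 0 x = g x := fun x hx => by simp [hx]
    refine ⟨Function.update g v 0, ?_, ?_, ?_⟩
    · intro a b hab
      by_cases hav : a = v <;> by_cases hbv : b = v
      · rw [hav, hbv]
      · rw [hav, hv, hne b hbv] at hab
        exact absurd hab (hg0 b).ne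
      · rw [hbv, hv, hne a hav] at hab
        exact absurd hab (hg0 a).ne'
      · rw [hne a hav, hne b hbv] at hab
        exact hg hab
    · intro x hx
      rw [hv, hne x hx]
      exact hg0 x
    · intro a b c hac hbc ha hb hab
      rcases a with a | i
      · rcases b with b | j
        · rcases c with c | k
          · have hcv : Sum.inl c ≠ v := by
              rintro rfl
              rw [hv] at ha
              exact absurd ha (Nat.not_lt_zero _)
            simp only [extended_adj_inl_inl] at hac hbc ⊢
            have hlt : ∀ a, a ≠ c →
                Function.update g v 0 (Sum.inl a) < Function.update g v 0 (Sum.inl c) →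
                f a < f c := by
              intro a hac h
              by_cases hav : Sum.inl a = v
              · exact h2 a c hav.symm hac.symm
              · rw [hne _ hav, hne _ hcv] at h
                simpa [g] using h
            exact h3 a b c hac hbc (hlt a hac.ne ha) (hlt b hbc.ne hb)
              (fun h => hab (by rw [h]))
          · exfalso
            have hcv : Sum.inr k ≠ v := by
              rintro rfl
              rw [hv] at ha
              exact absurd ha (Nat.not_lt_zero _)
            -- Only `v` can come before a dominating vertex from within `V`, so two distinct
            -- vertices of `V` cannot.
            have hlt : ∀ a, Function.update g v 0 (Sum.inl a) <
                Function.update g v 0 (Sum.inr k) → Sum.inl a = v := by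
              intro a h
              by_contra hav
              rw [hne _ hav, hne _ hcv] at h
              simp only [g, Sum.elim_inl, Sum.elim_inr] at h
              omega
            exact hab ((hlt a ha).trans (hlt b hb).symm)
        · simp
      · exact extended_adj_inr K i hab.symm
  rintro (v | i)
  · obtain ⟨f, h1, h2, h3⟩ := hK v
    exact key _ f h1 (fun x y hx hy => by
      obtain rfl := Sum.inl_injective hx
      exact h2 y hy) h3
  · rcases isEmpty_or_nonempty V with hV | ⟨⟨v⟩⟩
    · exact key _ (fun _ => 0) (fun a => isEmptyElim a) (by simp) (fun a => isEmptyElim a)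
    · obtain ⟨f, h1, h2, h3⟩ := hK v
      exact key _ f h1 (by simp) h3

/-! ### Walks avoiding a set, and acyclic moral orientations. -/

lemma Walk.reflTransGen_of_forall_notMem {G : SimpleGraph V} {S : Set V} {a b : V}
    (p : G.Walk a b) (hp : ∀ s ∈ S, s ∉ p.support) :
    Relation.ReflTransGen (fun x y => G.Adj x y ∧ x ∉ S ∧ y ∉ S) a b := by
  induction p with
  | nil => exact .refl
  | cons h q ih =>
    refine .head ⟨h, fun hs => hp _ hs (by simp), fun hs => hp _ hs (by simp)⟩ (ih fun s hs hsq => ?_)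
    exact hp s hs (by simp [hsq])

lemma exists_walk_of_reflTransGen {G : SimpleGraph V} {S : Set V} {a b : V} (ha : a ∉ S)
    (h : Relation.ReflTransGen (fun x y => G.Adj x y ∧ y ∉ S) a b) :
    ∃ p : G.Walk a b, ∀ s ∈ S, s ∉ p.support := by
  induction h using Relation.ReflTransGen.head_induction_on with
  | refl => exact ⟨.nil, fun s hs => by
      rw [Walk.support_nil, List.mem_singleton]
      rintro rfl
      exact ha hs⟩
  | head h _ ih =>
    obtain ⟨p, hp⟩ := ih h.2
    refine ⟨.cons h.1 p, fun s hs => ?_⟩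
    rw [Walk.support_cons, List.mem_cons, not_or]
    exact ⟨fun h => ha (h ▸ hs), hp s hs⟩

/-- The acyclic moral orientations of `K`: orientations that increase along a rank function and
in which any two parents of a vertex are adjacent. -/
structure IsMoralOrientation (K : SimpleGraph V) (R : V → V → Prop) : Prop where
  adj_iff : ∀ x y, K.Adj x y ↔ R x y ∨ R y x
  rank : ∃ f : V → ℕ, ∀ x y, R x y → f x < f y
  moral : ∀ a b c, R a c → R b c → a ≠ b → K.Adj a b

lemma IsMoralOrientation.adj {K : SimpleGraph V} {R : V → V → Prop} (h : K.IsMoralOrientation R)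
    {x y : V} (hxy : R x y) : K.Adj x y := (h.adj_iff x y).2 (.inl hxy)

lemma IsMoralOrientation.asymm {K : SimpleGraph V} {R : V → V → Prop}
    (h : K.IsMoralOrientation R) {x y : V} (hxy : R x y) : ¬ R y x := by
  obtain ⟨f, hf⟩ := h.rank
  exact fun hyx => lt_asymm (hf x y hxy) (hf y x hyx)

lemma acyclic_of_rank {R : V → V → Prop} (h : ∃ f : V → ℕ, ∀ x y, R x y → f x < f y) (v : V) :
    ¬ Relation.TransGen R v v := by
  obtain ⟨f, hf⟩ := h
  have key : ∀ x y, Relation.TransGen R x y → f x < f y := by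
    intro x y hxy
    induction hxy with
    | single h => exact hf _ _ h
    | tail _ h ih => exact ih.trans (hf _ _ h)
  exact fun hv => lt_irrefl _ (key v v hv)

/-- The rank is the number of strict ancestors: along an arrow `x → y` this set gains `x`, which
acyclicity keeps out of the ancestors of `x`. -/
lemma exists_rank_of_acyclic [Finite V] {R : V → V → Prop}
    (h : ∀ v, ¬ Relation.TransGen R v v) : ∃ f : V → ℕ, ∀ x y, R x y → f x < f y := by
  refine ⟨fun x => {y | Relation.TransGen R y x}.ncard, fun x y hxy => ?_⟩
  refine Set.ncard_lt_ncard ⟨fun z hz => Relation.TransGen.tail hz hxy, fun hss => ?_⟩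
    (Set.toFinite _)
  exact h x (hss (Relation.TransGen.single hxy))

/-- In a rootable graph every edge orientation extends to an acyclic moral orientation. -/
lemma IsRootable.exists_isMoralOrientation {K : SimpleGraph V} (hK : K.IsRootable) (v : V) :
    ∃ R, K.IsMoralOrientation R ∧ ∀ x, K.Adj v x → R v x := by
  obtain ⟨f, h1, h2, h3⟩ := hK v
  refine ⟨fun x y => K.Adj x y ∧ f x < f y, ⟨fun x y => ⟨fun h => ?_, ?_⟩, ⟨f, fun _ _ h => h.2⟩,
    fun a b c ha hb hab => h3 a b c ha.1 hb.1 ha.2 hb.2 hab⟩, fun x hx => ⟨hx, h2 x hx.ne'⟩⟩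
  · rcases lt_trichotomy (f x) (f y) with hf | hf | hf
    · exact .inl ⟨h, hf⟩
    · exact absurd (h1 hf) h.ne
    · exact .inr ⟨h.symm, hf⟩
  · rintro (h | h)
    · exact h.1
    · exact h.1.symm

end SimpleGraph

/-! ### d-separation and the Markov equivalence class of an undirected graph. -/

namespace DAG

open SimpleGraph

variable {V : Type*}

lemma irrefl (D : DAG V) (v : V) : ¬ D.Adj v v := fun h => D.acyclic v (.single h)

lemma skeleton_adj (D : DAG V) {u v : V} : D.skeleton.Adj u v ↔ D.Adj u v ∨ D.Adj v u := by
  unfold skeleton Digraph.toSimpleGraphInclusive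
  rw [fromRel_adj, and_iff_right_iff_imp]
  rintro (h | h) rfl <;> exact D.irrefl _ h

lemma moralGraph_adj (D : DAG V) {T : Set V} {u v : V} : (D.moralGraph T).Adj u v ↔
    u ≠ v ∧ u ∈ T ∧ v ∈ T ∧ (D.Adj u v ∨ D.Adj v u ∨ ∃ w ∈ T, D.Adj u w ∧ D.Adj v w) := by
  unfold moralGraph
  rw [fromRel_adj]
  constructor
  · rintro ⟨hne, ⟨hu, hv, h | h⟩ | ⟨hv, hu, h | ⟨w, hw, h⟩⟩⟩
    · exact ⟨hne, hu, hv, .inl h⟩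
    · exact ⟨hne, hu, hv, .inr (.inr h)⟩
    · exact ⟨hne, hu, hv, .inr (.inl h)⟩
    · exact ⟨hne, hu, hv, .inr (.inr ⟨w, hw, h.2, h.1⟩)⟩
  · rintro ⟨hne, hu, hv, h | h | h⟩
    · exact ⟨hne, .inl ⟨hu, hv, .inl h⟩⟩
    · exact ⟨hne, .inr ⟨hv, hu, .inl h⟩⟩
    · exact ⟨hne, .inl ⟨hu, hv, .inr h⟩⟩

lemma subset_ancestors (D : DAG V) (X : Set V) : X ⊆ D.ancestors X :=
  fun x hx => ⟨x, hx, .refl⟩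

lemma mem_ancestors_of_adj (D : DAG V) {X : Set V} {u v : V} (h : D.Adj u v)
    (hv : v ∈ D.ancestors X) : u ∈ D.ancestors X := by
  obtain ⟨w, hw, hvw⟩ := hv
  exact ⟨w, hw, .head h hvw⟩

lemma not_encodesIndep_of_moralGraph_adj (D : DAG V) {a b : V} {S : Set V} (ha : a ∉ S)
    (hb : b ∉ S) (h : (D.moralGraph (D.ancestors ({a} ∪ {b} ∪ S))).Adj a b) :
    ¬ D.EncodesIndep {a} {b} S := by
  intro hI
  obtain ⟨s, hs, hs'⟩ := hI a rfl b rfl h.toWalk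
  simp only [Walk.support_cons, Walk.support_nil, List.mem_cons,
    List.not_mem_nil, or_false] at hs'
  rcases hs' with rfl | rfl
  · exact ha hs
  · exact hb hs

lemma not_encodesIndep_of_adj (D : DAG V) {a b : V} {S : Set V} (ha : a ∉ S)
    (hb : b ∉ S) (h : D.skeleton.Adj a b) : ¬ D.EncodesIndep {a} {b} S := by
  refine D.not_encodesIndep_of_moralGraph_adj ha hb (D.moralGraph_adj.2 ⟨h.ne, ?_, ?_, ?_⟩)
  · exact D.subset_ancestors _ (by simp)
  · exact D.subset_ancestors _ (by simp)
  · rw [skeleton_adj] at h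
    tauto

/-- Conditioning on ancestors does not enlarge the ancestral set, so a walk from `a` avoiding the
conditioning set must step directly to `b`. That step would need a common child that is an ancestor
of `a` or `b`, hence a directed cycle. -/
lemma encodesIndep_of_not_adj (D : DAG V) {a b : V} (hab : a ≠ b) (h : ¬ D.skeleton.Adj a b) :
    D.EncodesIndep {a} {b} (D.ancestors {a, b} \ {a, b}) := by
  rintro x rfl y rfl p
  have hT : D.ancestors ({x} ∪ {y} ∪ (D.ancestors {x, y} \ {x, y})) ⊆ D.ancestors {x, y} := by
    rintro u ⟨w, hw, huw⟩
    have hw' : w ∈ D.ancestors {x, y} := by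
      rcases hw with (rfl | rfl) | hw
      · exact D.subset_ancestors _ (by simp)
      · exact D.subset_ancestors _ (by simp)
      · exact hw.1
    obtain ⟨z, hz, hwz⟩ := hw'
    exact ⟨z, hz, huw.trans hwz⟩
  cases p with
  | nil => exact absurd rfl hab
  | @cons _ z _ hz q =>
    by_cases hzS : z ∈ D.ancestors {x, y} \ {x, y}
    · exact ⟨z, hzS, List.mem_cons_of_mem _ q.start_mem_support⟩
    exfalso
    rw [moralGraph_adj] at hz
    obtain ⟨hxz, -, hzT, hz⟩ := hz
    have hzy : z = y := by
      by_contra hne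
      exact hzS ⟨hT hzT, by simp [hxz.symm, hne]⟩
    subst hzy
    rw [skeleton_adj] at h
    rcases hz with hz | hz | ⟨w, hw, h1, h2⟩
    · exact h (.inl hz)
    · exact h (.inr hz)
    · obtain ⟨u, rfl | rfl, hwu⟩ := hT hw
      · exact D.acyclic _ (.head' h1 hwu)
      · exact D.acyclic _ (.head' h2 hwu)

lemma MarkovEquiv.symm {D D' : DAG V} (h : D.MarkovEquiv D') : D'.MarkovEquiv D :=
  fun A B S h1 h2 h3 => (h A B S h1 h2 h3).symm

lemma MarkovEquiv.encodesIndep_singleton {D D' : DAG V} (h : D.MarkovEquiv D') {a b : V}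
    {S : Set V} (hab : a ≠ b) (ha : a ∉ S) (hb : b ∉ S) :
    D.EncodesIndep {a} {b} S ↔ D'.EncodesIndep {a} {b} S :=
  h _ _ _ (by simpa using hab) (by simpa using ha) (by simpa using hb)

/-- Nonadjacent vertices are separated by some set, adjacent ones by none. -/
lemma MarkovEquiv.skeleton_adj {D D' : DAG V} (h : D.MarkovEquiv D') {a b : V}
    (hab : D.skeleton.Adj a b) : D'.skeleton.Adj a b := by
  by_contra hn
  have := D'.encodesIndep_of_not_adj hab.ne hn
  rw [← h.encodesIndep_singleton hab.ne (by simp) (by simp)] at this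
  exact D.not_encodesIndep_of_adj (by simp) (by simp) hab this

/-- Markov equivalent DAGs have the same immoralities. -/
lemma MarkovEquiv.adj_of_immorality {D D' : DAG V} (h : D.MarkovEquiv D') {a b c : V}
    (hac : D.Adj a c) (hbc : D.Adj b c) (hab : a ≠ b) (hn : ¬ D.skeleton.Adj a b) :
    D'.Adj a c := by
  by_contra hac'
  have hn' : ¬ D'.skeleton.Adj a b := fun h' => hn (h.symm.skeleton_adj h')
  have hca : D'.Adj c a :=
    (D'.skeleton_adj.1 (h.skeleton_adj (D.skeleton_adj.2 (.inl hac)))).resolve_left hac'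
  have hne : ∀ {x y}, D.Adj x y → y ≠ x := by
    rintro x y hxy rfl
    exact D.irrefl _ hxy
  have hI := D'.encodesIndep_of_not_adj hab hn'
  rw [← h.encodesIndep_singleton hab (by simp) (by simp)] at hI
  -- The arrow `c → a` of `D'` puts `c` into the set that separates `a` and `b` in `D'`.
  -- Conditioning on their common child `c` marries them in `D`.
  have hc : c ∈ D.ancestors ({a} ∪ {b} ∪ (D'.ancestors {a, b} \ {a, b})) := by
    refine D.subset_ancestors _ (.inr ⟨⟨a, by simp, .single hca⟩, ?_⟩)
    simp [hne hac, hne hbc]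
  refine D.not_encodesIndep_of_moralGraph_adj (by simp) (by simp) ?_ hI
  exact D.moralGraph_adj.2 ⟨hab, D.mem_ancestors_of_adj hac hc, D.mem_ancestors_of_adj hbc hc,
    .inr (.inr ⟨c, hc, hac, hbc⟩)⟩

/-- In an acyclic moral orientation, d-separation is separation in the skeleton. -/
lemma encodesIndep_iff_of_isMoralOrientation [Finite V] {D : DAG V} {K : SimpleGraph V}
    (h : K.IsMoralOrientation D.Adj) (A B S : Set V) : D.EncodesIndep A B S ↔
      ∀ a ∈ A, ∀ b ∈ B, ∀ p : K.Walk a b, ∃ s ∈ S, s ∈ p.support := by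
  constructor
  · intro hI a ha b hb p
    by_contra! hp
    obtain ⟨f, hf⟩ := h.rank
    set T := D.ancestors (A ∪ B ∪ S) with hT
    have haT : a ∈ T := D.subset_ancestors _ (by simp [ha])
    have hbT : b ∈ T := D.subset_ancestors _ (by simp [hb])
    -- The walk is pushed into `T` by lowering `n`. A vertex outside `T` of rank exactly `n` has
    -- only parents next to it on the walk, since `T` is ancestral and children rank higher; those
    -- parents are equal or adjacent, so it can be bypassed. At `n = 0` only `T` remains.
    let U : ℕ → V → Prop := fun n x => x ∉ S ∧ (x ∈ T ∨ f x < n)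
    have haU : ∀ n, U n a := fun n => ⟨fun hs => hp a hs (by simp), .inl haT⟩
    have hbU : ∀ n, U n b := fun n => ⟨fun hs => hp b hs (by simp), .inl hbT⟩
    have hstep : ∀ n, Relation.ReflTransGen (fun x y => K.Adj x y ∧ U n x ∧ U n y) a b →
        Relation.ReflTransGen (fun x y => K.Adj x y ∧ U 0 x ∧ U 0 y) a b := by
      intro n
      induction n with
      | zero => exact id
      | succ n ih =>
        intro hr
        apply ih
        have hpar : ∀ x z, K.Adj z x → ¬ U n x → U (n + 1) x → U (n + 1) z →
            D.Adj z x ∧ U n z := by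
          intro x z hzx hx hx1 hz1
          have hxT : x ∉ T := fun hxT => hx ⟨hx1.1, .inl hxT⟩
          have hfx : f x < n + 1 := hx1.2.resolve_left hxT
          have hzx' : D.Adj z x := by
            refine ((h.adj_iff z x).1 hzx).resolve_right fun hxz => ?_
            rcases hz1.2 with hzT | hzf
            · exact hxT (D.mem_ancestors_of_adj hxz hzT)
            · exact hx ⟨hx1.1, .inr (by have := hf _ _ hxz; omega)⟩
          exact ⟨hzx', hz1.1, .inr (by have := hf _ _ hzx'; omega)⟩
        have hUmono : ∀ x, U n x → U (n + 1) x := fun x hx => ⟨hx.1, hx.2.imp_right (by omega)⟩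
        let r : V → V → Prop := fun x y => K.Adj x y ∧ U n x ∧ U n y
        -- The second clause handles a start that has to be skipped: any neighbor in `U n` preceding
        -- it on the walk still reaches `b`.
        suffices H : (U n a → Relation.ReflTransGen r a b) ∧
            (¬ U n a → ∀ y, K.Adj y a → U n y → Relation.ReflTransGen r y b) from H.1 (haU n)
        · clear ih haU haT hp p ha
          induction hr using Relation.ReflTransGen.head_induction_on with
          | refl => exact ⟨fun _ => .refl, fun hn => absurd (hbU n) hn⟩
          | @head x z hxz _ ih' =>
            obtain ⟨hxz, hx, hz⟩ := hxz
            constructor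
            · intro hxU
              by_cases hzU : U n z
              · exact .head ⟨hxz, hxU, hzU⟩ (ih'.1 hzU)
              · exact ih'.2 hzU x hxz hxU
            · intro hxU y hyx hyU
              obtain ⟨hzx, hzU⟩ := hpar x z hxz.symm hxU hx hz
              obtain ⟨hyx, -⟩ := hpar x y hyx hxU hx (hUmono y hyU)
              by_cases hyz : y = z
              · subst hyz; exact ih'.1 hyU
              · exact .head ⟨h.moral y z x hyx hzx hyz, hyU, hzU⟩ (ih'.1 hzU)
    obtain ⟨N, hN⟩ := (Set.finite_range f).bddAbove
    have hall : ∀ x, f x < N + 1 := fun x => Nat.lt_succ_of_le (hN ⟨x, rfl⟩)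
    have h0 := hstep (N + 1) (Relation.ReflTransGen.mono (fun x y hxy =>
      ⟨hxy.1, ⟨hxy.2.1, .inr (hall x)⟩, ⟨hxy.2.2, .inr (hall y)⟩⟩) _ _
      (p.reflTransGen_of_forall_notMem hp))
    have h1 : Relation.ReflTransGen (fun x y => (D.moralGraph T).Adj x y ∧ y ∉ S) a b := by
      refine Relation.ReflTransGen.mono (fun x y ⟨hxy, hx, hy⟩ =>
        ⟨D.moralGraph_adj.2 ⟨hxy.ne, ?_, ?_, ?_⟩, hy.1⟩) _ _ h0
      · exact hx.2.resolve_right (Nat.not_lt_zero _)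
      · exact hy.2.resolve_right (Nat.not_lt_zero _)
      · rcases (h.adj_iff x y).1 hxy with h' | h'
        · exact .inl h'
        · exact .inr (.inl h')
    obtain ⟨q, hq⟩ := exists_walk_of_reflTransGen (haU 0).1 h1
    obtain ⟨s, hs, hsq⟩ := hI a ha b hb q
    exact hq s hs hsq
  · intro hI a ha b hb p
    have hle : D.moralGraph (D.ancestors (A ∪ B ∪ S)) ≤ K := by
      intro x y hxy
      obtain ⟨hne, -, -, h1 | h1 | ⟨w, -, h1, h2⟩⟩ := D.moralGraph_adj.1 hxy
      · exact h.adj h1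
      · exact (h.adj h1).symm
      · exact h.moral x y w h1 h2 hne
    simpa using hI a ha b hb (p.mapLe hle)

lemma markovEquiv_of_isMoralOrientation [Finite V] {D D' : DAG V} {K : SimpleGraph V}
    (h : K.IsMoralOrientation D.Adj) (h' : K.IsMoralOrientation D'.Adj) : D.MarkovEquiv D' := by
  intro A B S _ _ _
  rw [encodesIndep_iff_of_isMoralOrientation h, encodesIndep_iff_of_isMoralOrientation h']

/-- The DAGs in the Markov equivalence class represented by an undirected rootable graph are its
acyclic moral orientations. -/
lemma mem_markovClass_toMixedGraph_iff [Finite V] {D : DAG V} {K : SimpleGraph V}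
    (hK : K.IsRootable) :
    D ∈ K.toMixedGraph.markovClass ↔ K.IsMoralOrientation D.Adj := by
  constructor
  · intro hD
    have hD : D.essentialGraph = K.toMixedGraph := hD
    have harrow : ∀ u v, D.skeleton.Adj u v → ¬ D.Compelled u v := by
      intro u v huv hc
      have : D.essentialGraph.arrow u v := ⟨huv, hc⟩
      rw [hD] at this
      exact this
    have hline : ∀ u v, K.Adj u v ↔ D.skeleton.Adj u v := by
      intro u v
      have : K.Adj u v ↔ D.essentialGraph.line u v := by rw [hD]; rfl
      rw [this]
      exact ⟨fun h => h.1, fun h => ⟨h, harrow u v h, harrow v u h.symm⟩⟩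
    refine ⟨fun x y => by rw [hline, skeleton_adj], exists_rank_of_acyclic D.acyclic, ?_⟩
    intro a b c hac hbc hab
    by_contra hn
    rw [hline] at hn
    exact harrow a c (D.skeleton_adj.2 (.inl hac))
      fun D' hD' => hD'.adj_of_immorality hac hbc hab hn
  · intro h
    have hskel : ∀ u v, D.skeleton.Adj u v ↔ K.Adj u v := fun u v => by
      rw [skeleton_adj, h.adj_iff]
    -- Any orientation with root `v` belongs to the class and reverses `u → v`.
    have hcomp : ∀ u v, K.Adj u v → ¬ D.Compelled u v := by
      intro u v huv hc
      obtain ⟨R, hR, hv⟩ := hK.exists_isMoralOrientation v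
      have := hc ⟨⟨R⟩, acyclic_of_rank hR.rank⟩ (markovEquiv_of_isMoralOrientation h hR)
      exact hR.asymm this (hv u huv.symm)
    change D.essentialGraph = K.toMixedGraph
    unfold essentialGraph SimpleGraph.toMixedGraph
    congr 1
    · funext u v
      rw [hskel]
      exact propext ⟨fun h => h.1, fun h => ⟨h, hcomp u v h, hcomp v u h.symm⟩⟩
    · funext u v
      rw [hskel]
      exact propext ⟨fun h => hcomp u v h.1 h.2, False.elim⟩

end DAG

namespace SimpleGraph

variable {V : Type*} [Finite V] {K : SimpleGraph V}

lemma IsRootable.size_eq (hK : K.IsRootable) :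
    K.size = Nat.card {R : V → V → Prop // K.IsMoralOrientation R} := by
  refine Nat.card_congr ⟨fun D => ⟨D.1.Adj, (DAG.mem_markovClass_toMixedGraph_iff hK).1 D.2⟩,
    fun R => ⟨⟨⟨R.1⟩, acyclic_of_rank R.2.rank⟩, ?_⟩, fun _ => rfl, fun _ => rfl⟩
  exact (DAG.mem_markovClass_toMixedGraph_iff hK).2 R.2

lemma IsRootable.rootedSize_eq (hK : K.IsRootable) (v : V) : K.rootedSize v =
    Nat.card {R : V → V → Prop // K.IsMoralOrientation R ∧ ∀ u, ¬ R u v} := by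
  refine Nat.card_congr ⟨fun D => ⟨D.1.Adj,
    (DAG.mem_markovClass_toMixedGraph_iff hK).1 D.2.1, D.2.2⟩,
    fun R => ⟨⟨⟨R.1⟩, acyclic_of_rank R.2.1.rank⟩, ?_, R.2.2⟩, fun _ => rfl, fun _ => rfl⟩
  exact (DAG.mem_markovClass_toMixedGraph_iff hK).2 R.2.1

end SimpleGraph

/-! ### Splitting an orientation at a root. -/

namespace SimpleGraph

variable {V : Type*}

/-- The part of an acyclic moral orientation with root `v` that consists of the arrows into
vertices other than `v` and its neighbors. -/
structure IsOuterOrientation (G : SimpleGraph V) (v : V) (R : V → V → Prop) : Prop where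
  far : ∀ x y, R x y → y ≠ v ∧ ¬ G.Adj v y
  adj : ∀ x y, R x y → G.Adj x y
  total : ∀ x y, G.Adj x y → y ≠ v → ¬ G.Adj v y → R x y ∨ R y x
  rank : ∃ f : V → ℕ, ∀ x y, R x y → f x < f y
  moral : ∀ a b c, R a c → R b c → a ≠ b → G.Adj a b

/-- The number of acyclic moral orientations. -/
noncomputable def moralCount (G : SimpleGraph V) : ℕ :=
  Nat.card {R : V → V → Prop // G.IsMoralOrientation R}

/-- The number of acyclic moral orientations with root `v`. -/
noncomputable def rootedCount (G : SimpleGraph V) (v : V) : ℕ :=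
  Nat.card {R : V → V → Prop // G.IsMoralOrientation R ∧ ∀ u, ¬ R u v}

/-- The number of outer orientations with respect to `v`. -/
noncomputable def outerCount (G : SimpleGraph V) (v : V) : ℕ :=
  Nat.card {R : V → V → Prop // G.IsOuterOrientation v R}

section factor

variable {W : Type*} {G : SimpleGraph V} {H : SimpleGraph W} {v : V} {e : W → V}

lemma IsMoralOrientation.comap {R : V → V → Prop} (he : Function.Injective e)
    (hH : ∀ x y, H.Adj x y ↔ G.Adj (e x) (e y)) (h : G.IsMoralOrientation R) :
    H.IsMoralOrientation fun x y => R (e x) (e y) := by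
  refine ⟨fun x y => by rw [hH, h.adj_iff], ?_,
    fun a b c hac hbc hab => (hH a b).2 (h.moral _ _ _ hac hbc (he.ne hab))⟩
  obtain ⟨f, hf⟩ := h.rank
  exact ⟨fun x => f (e x), fun x y => hf _ _⟩

lemma IsMoralOrientation.isOuterOrientation {R : V → V → Prop} (h : G.IsMoralOrientation R)
    (hv : ∀ u, ¬ R u v) :
    G.IsOuterOrientation v fun x y => R x y ∧ y ≠ v ∧ ¬ G.Adj v y := by
  refine ⟨fun x y h => h.2, fun x y hR => h.adj hR.1, ?_, ?_,
    fun a b c hac hbc => h.moral a b c hac.1 hbc.1⟩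
  · intro x y hxy hyv hvy
    rcases (h.adj_iff x y).1 hxy with hR | hR
    · exact .inl ⟨hR, hyv, hvy⟩
    · refine .inr ⟨hR, ?_, fun hvx => ?_⟩
      · rintro rfl
        exact hv _ hR
      -- Otherwise `v` and `y` would be two parents of `x`, hence adjacent.
      · have hvx' : R v x := ((h.adj_iff v x).1 hvx).resolve_right (hv x)
        exact hvy (h.moral v y x hvx' hR hyv.symm)
  · obtain ⟨f, hf⟩ := h.rank
    exact ⟨f, fun x y h => hf x y h.1⟩

lemma IsMoralOrientation.glue [Finite W] (he : Function.Injective e)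
    (hN : ∀ x, G.Adj v x ↔ ∃ w, e w = x) (hH : ∀ x y, H.Adj x y ↔ G.Adj (e x) (e y))
    {α : W → W → Prop} {ω : V → V → Prop} (hα : H.IsMoralOrientation α)
    (hω : G.IsOuterOrientation v ω) :
    G.IsMoralOrientation
      fun x y => ω x y ∨ (x = v ∧ G.Adj v y) ∨ Relation.Map α e e x y := by
  classical
  have hve : ∀ w, G.Adj v (e w) := fun w => (hN _).2 ⟨w, rfl⟩
  have hadj : ∀ x y, ω x y ∨ (x = v ∧ G.Adj v y) ∨ Relation.Map α e e x y → G.Adj x y := by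
    rintro x y (h | ⟨rfl, h⟩ | ⟨a, b, hab, rfl, rfl⟩)
    · exact hω.adj x y h
    · exact h
    · exact (hH a b).1 (hα.adj hab)
  refine ⟨fun x y => ⟨fun hxy => ?_, fun h => ?_⟩, ?_, ?_⟩
  · by_cases hyv : y = v
    · subst hyv
      exact .inr (.inr (.inl ⟨rfl, hxy.symm⟩))
    by_cases hvy : G.Adj v y
    · by_cases hxv : x = v
      · subst hxv
        exact .inl (.inr (.inl ⟨rfl, hxy⟩))
      by_cases hvx : G.Adj v x
      · obtain ⟨a, rfl⟩ := (hN x).1 hvx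
        obtain ⟨b, rfl⟩ := (hN y).1 hvy
        rcases (hα.adj_iff a b).1 ((hH a b).2 hxy) with h | h
        · exact .inl (.inr (.inr ⟨a, b, h, rfl, rfl⟩))
        · exact .inr (.inr (.inr ⟨b, a, h, rfl, rfl⟩))
      · rcases hω.total y x hxy.symm hxv hvx with h | h
        · exact .inr (.inl h)
        · exact .inl (.inl h)
    · rcases hω.total x y hxy hyv hvy with h | h
      · exact .inl (.inl h)
      · exact .inr (.inl h)
  · rcases h with h | h
    · exact hadj x y h
    · exact (hadj y x h).symm
  · obtain ⟨a, ha⟩ := hα.rank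
    obtain ⟨g, hg⟩ := hω.rank
    obtain ⟨N, hN'⟩ := (Set.finite_range a).bddAbove
    have haN : ∀ w, a w ≤ N := fun w => hN' ⟨w, rfl⟩
    -- Rank 0 for `v`, ranks 1 to `N + 1` for its neighbors, ranks from `N + 2` on for the rest, so
    -- every outer arrow ascends.
    let f : V → ℕ := fun x => if x = v then 0 else
      if h : ∃ w, e w = x then 1 + a h.choose else N + 2 + g x
    have hfv : f v = 0 := by simp [f]
    have hfe : ∀ w, f (e w) = 1 + a w := by
      intro w
      have h : ∃ w', e w' = e w := ⟨w, rfl⟩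
      simp only [f, if_neg (hve w).ne', dif_pos h]
      rw [he h.choose_spec]
    have hff : ∀ x, x ≠ v → ¬ G.Adj v x → f x = N + 2 + g x := by
      intro x hx hvx
      rw [hN] at hvx
      simp only [f, if_neg hx, dif_neg hvx]
    refine ⟨f, ?_⟩
    rintro x y (h | ⟨rfl, h⟩ | ⟨c, d, hcd, rfl, rfl⟩)
    · obtain ⟨hy, hvy⟩ := hω.far x y h
      rw [hff y hy hvy]
      by_cases hx : x = v
      · subst hx; omega
      by_cases hvx : G.Adj v x
      · obtain ⟨w, rfl⟩ := (hN x).1 hvx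
        rw [hfe]
        have := haN w
        omega
      · rw [hff x hx hvx]
        have := hg x y h
        omega
    · obtain ⟨w, rfl⟩ := (hN y).1 h
      rw [hfv, hfe]
      omega
    · rw [hfe, hfe]
      have := ha c d hcd
      omega
  · have hinner : ∀ {x c}, G.Adj v c → ω x c ∨ (x = v ∧ G.Adj v c) ∨ Relation.Map α e e x c →
        x = v ∨ Relation.Map α e e x c := by
      rintro x c hvc (h | h | h)
      · exact absurd hvc (hω.far x c h).2
      · exact .inl h.1
      · exact .inr h
    have houter : ∀ {x c}, ¬ G.Adj v c → ω x c ∨ (x = v ∧ G.Adj v c) ∨ Relation.Map α e e x c →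
        ω x c := by
      rintro x c hvc (h | h | ⟨p, q, -, -, rfl⟩)
      · exact h
      · exact absurd h.2 hvc
      · exact absurd (hve q) hvc
    intro x y c hx hy hxy
    by_cases hvc : G.Adj v c
    · rcases hinner hvc hx with rfl | ⟨a, c', hac, rfl, rfl⟩ <;>
        rcases hinner hvc hy with rfl | ⟨b, d, hbd, rfl, hd⟩
      · exact absurd rfl hxy
      · exact hve b
      · exact (hve a).symm
      · obtain rfl := he hd
        exact (hH a b).1 (hα.moral a b d hac hbd fun h => hxy (h ▸ rfl))
    · exact hω.moral x y c (houter hvc hx) (houter hvc hy) hxy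

/-- An acyclic moral orientation with root `v` consists of an acyclic moral orientation of the
neighborhood of `v` and an outer orientation, chosen independently. -/
lemma rootedCount_eq_mul [Finite W] (he : Function.Injective e)
    (hN : ∀ x, G.Adj v x ↔ ∃ w, e w = x) (hH : ∀ x y, H.Adj x y ↔ G.Adj (e x) (e y)) :
    G.rootedCount v = H.moralCount * G.outerCount v := by
  unfold rootedCount moralCount outerCount
  rw [← Nat.card_prod]
  have hve : ∀ w, G.Adj v (e w) := fun w => (hN _).2 ⟨w, rfl⟩
  refine Nat.card_congr ⟨fun R => ⟨⟨_, R.2.1.comap he hH⟩, ⟨_, R.2.1.isOuterOrientation R.2.2⟩⟩,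
    fun p => ⟨_, p.1.2.glue he hN hH p.2.2, ?_⟩, ?_, ?_⟩
  · rintro u (h | h | ⟨a, b, -, -, h⟩)
    · exact (p.2.2.far u v h).1 rfl
    · exact h.2.ne rfl
    · exact (hve b).ne h.symm
  · rintro ⟨R, hR, hv⟩
    apply Subtype.ext
    funext x y
    simp only [eq_iff_iff]
    constructor
    · rintro (h | ⟨rfl, h⟩ | ⟨a, b, h, rfl, rfl⟩)
      · exact h.1
      · exact ((hR.adj_iff x y).1 h).resolve_right (hv y)
      · exact h
    · intro h
      by_cases hvy : G.Adj v y
      · by_cases hxv : x = v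
        · exact .inr (.inl ⟨hxv, hvy⟩)
        · have hvy' : R v y := ((hR.adj_iff v y).1 hvy).resolve_right (hv y)
          obtain ⟨a, rfl⟩ := (hN x).1 (hR.moral v x y hvy' h (Ne.symm hxv))
          obtain ⟨b, rfl⟩ := (hN y).1 hvy
          exact .inr (.inr ⟨a, b, h, rfl, rfl⟩)
      · refine .inl ⟨h, ?_, hvy⟩
        rintro rfl
        exact hv x h
  · rintro ⟨⟨α, hα⟩, ⟨ω, hω⟩⟩
    refine Prod.ext (Subtype.ext ?_) (Subtype.ext ?_)
    · funext x y
      simp only [eq_iff_iff]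
      constructor
      · rintro (h | ⟨h, -⟩ | ⟨a, b, h, ha, hb⟩)
        · exact absurd (hve y) (hω.far _ _ h).2
        · exact absurd h (hve x).ne'
        · rwa [he ha, he hb] at h
      · exact fun h => .inr (.inr ⟨x, y, h, rfl, rfl⟩)
    · funext x y
      simp only [eq_iff_iff]
      constructor
      · rintro ⟨h | ⟨-, h⟩ | ⟨a, b, -, -, rfl⟩, -, h'⟩
        · exact h
        · exact absurd h h'
        · exact absurd (hve b) h'
      · exact fun h => ⟨.inl h, hω.far x y h⟩

lemma moralCount_congr (e : W ≃ V) (hH : ∀ x y, H.Adj x y ↔ G.Adj (e x) (e y)) :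
    H.moralCount = G.moralCount := by
  refine Nat.card_congr ⟨fun R => ⟨fun x y => R.1 (e.symm x) (e.symm y),
    R.2.comap e.symm.injective (fun x y => by simp [hH])⟩,
    fun R => ⟨fun x y => R.1 (e x) (e y), R.2.comap e.injective hH⟩,
    fun R => Subtype.ext ?_, fun R => Subtype.ext ?_⟩
  · funext x y; simp
  · funext x y; simp

end factor

/-! ### Adding dominating vertices: the recursion for the counts. -/

lemma outerCount_eq_one {G : SimpleGraph V} {v : V} (hv : ∀ x, x ≠ v → G.Adj v x) :
    G.outerCount v = 1 := by
  have hfalse : ∀ R, G.IsOuterOrientation v R → R = fun _ _ => False := by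
    intro R hR
    funext x y
    simp only [eq_iff_iff, iff_false]
    exact fun h => (hR.far x y h).2 (hv y (hR.far x y h).1)
  refine Nat.card_eq_one_iff_exists.2 ⟨⟨fun _ _ => False, ?_⟩,
    fun R => Subtype.ext (hfalse R.1 R.2)⟩
  refine ⟨fun _ _ h => h.elim, fun _ _ h => h.elim, fun x y _ hy hvy => absurd (hv y hy) hvy,
    ⟨fun _ => 0, fun _ _ h => h.elim⟩, fun _ _ _ h => h.elim⟩

/-- Dominating vertices are neighbors of `v`, so no outer arrow enters them, and their edges to
outer vertices all point outwards. They leave no choice. -/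
lemma outerCount_extended (K : SimpleGraph V) (m : ℕ) (v : V) :
    (K.extended m).outerCount (.inl v) = K.outerCount v := by
  refine Nat.card_congr ⟨fun R => ⟨fun x y => R.1 (.inl x) (.inl y), ?_⟩,
    fun R => ⟨fun x y => Sum.elim
      (fun y => Sum.elim (fun x => R.1 x y) (fun _ => y ≠ v ∧ ¬ K.Adj v y) x)
      (fun _ => False) y, ?_⟩, ?_, ?_⟩
  · obtain ⟨R, hR⟩ := R
    refine ⟨fun x y h => ?_, fun x y h => ?_, fun x y hxy hy hvy => ?_, ?_, ?_⟩
    · simpa using hR.far _ _ h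
    · simpa using hR.adj _ _ h
    · exact hR.total (.inl x) (.inl y) (by simpa using hxy) (by simpa using hy)
        (by simpa using hvy)
    · obtain ⟨f, hf⟩ := hR.rank
      exact ⟨fun x => f (.inl x), fun x y => hf _ _⟩
    · intro a b c ha hb hab
      simpa using hR.moral _ _ _ ha hb (by simpa using hab)
  · obtain ⟨R, hR⟩ := R
    refine ⟨?_, ?_, ?_, ?_, ?_⟩
    · rintro (x | i) (y | j) h
      · simpa using hR.far x y h
      · exact h.elim
      · simpa using h
      · exact h.elim
    · rintro (x | i) (y | j) h
      · simpa using hR.adj x y h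
      · exact h.elim
      · simp
      · exact h.elim
    · rintro (x | i) (y | j) hxy hy hvy
      · simpa using hR.total x y (by simpa using hxy) (by simpa using hy) (by simpa using hvy)
      · simp at hvy
      · exact .inl ⟨by simpa using hy, by simpa using hvy⟩
      · simp at hvy
    · obtain ⟨f, hf⟩ := hR.rank
      refine ⟨Sum.elim (fun x => f x + 1) (fun _ => 0), ?_⟩
      rintro (x | i) (y | j) h
      · simpa using hf x y h
      · exact h.elim
      · simp
      · exact h.elim
    · rintro (a | i) (b | j) (c | k) ha hb hab
      · simpa using hR.moral a b c ha hb (by simpa using hab)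
      · exact ha.elim
      · simp
      · simp
      · simp
      · simp
      · simpa using hab
      · simpa using hab
  · rintro ⟨R, hR⟩
    have hinr : ∀ x j, ¬ R x (.inr j) := fun x j h => (hR.far _ _ h).2 (by simp)
    apply Subtype.ext
    funext x y
    rcases y with y | j
    · rcases x with x | i
      · rfl
      · simp only [Sum.elim_inl, Sum.elim_inr, eq_iff_iff]
        refine ⟨fun h => ?_, fun h => by simpa using hR.far _ _ h⟩
        exact (hR.total (.inr i) (.inl y) (by simp) (by simpa using h.1)
          (by simpa using h.2)).resolve_right (hinr _ _)
    · simpa using hinr x j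
  · rintro ⟨R, hR⟩
    rfl

/-- If some vertex dominates the graph, every acyclic moral orientation has exactly one root. -/
lemma moralCount_eq_sum_rootedCount [Fintype V] {G : SimpleGraph V} {u : V}
    (hu : ∀ x, x ≠ u → G.Adj u x) : G.moralCount = ∑ v, G.rootedCount v := by
  unfold moralCount rootedCount
  rw [← Nat.card_sigma]
  symm
  refine Nat.card_congr (Equiv.ofBijective (fun p => ⟨p.2.1, p.2.2.1⟩) ⟨?_, ?_⟩)
  · rintro ⟨v, R, hR, hv⟩ ⟨w, R', hR', hw⟩ h
    obtain rfl : R = R' := congrArg Subtype.val h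
    -- Two distinct roots would be nonadjacent, hence both different from `u` and both parents of
    -- `u`, against morality.
    have hvw : v = w := by
      by_contra hne
      have hn : ¬ G.Adj v w := fun h => ((hR.adj_iff v w).1 h).elim (hw v) (hv w)
      have huv : v ≠ u := by
        rintro rfl
        exact hn (hu w (Ne.symm hne))
      have huw : w ≠ u := by
        rintro rfl
        exact hn (hu v hne).symm
      have h1 : R v u := ((hR.adj_iff v u).1 (hu v huv).symm).resolve_right (hv u)
      have h2 : R w u := ((hR.adj_iff w u).1 (hu w huw).symm).resolve_right (hw u)
      exact hn (hR.moral v w u h1 h2 hne)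
    subst hvw
    rfl
  · rintro ⟨R, hR⟩
    obtain ⟨f, hf⟩ := hR.rank
    have : Nonempty V := ⟨u⟩
    obtain ⟨v, hv⟩ := Finite.exists_min f
    exact ⟨⟨v, R, hR, fun x hx => absurd (hf x v hx) (not_lt.2 (hv x))⟩, rfl⟩

lemma rootedCount_eq [Finite V] (K : SimpleGraph V) (v : V) :
    K.rootedCount v = (K.nbrGraph v).moralCount * K.outerCount v :=
  rootedCount_eq_mul (e := Subtype.val) Subtype.val_injective (fun x => by simp)
    (fun x y => Iff.rfl)

lemma rootedCount_extended_inl [Finite V] (K : SimpleGraph V) (m : ℕ) (v : V) :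
    (K.extended m).rootedCount (.inl v) =
      ((K.nbrGraph v).extended m).moralCount * K.outerCount v := by
  rw [← outerCount_extended K m]
  refine rootedCount_eq_mul (e := Sum.map Subtype.val id)
    (Function.Injective.sumMap Subtype.val_injective Function.injective_id) ?_ ?_
  · rintro (x | i) <;> simp
  · rintro (x | i) (y | j) <;> simp [nbrGraph]

/-- A dominating root has no outer vertices, and its neighborhood is `K` with one dominating vertex
fewer. -/
lemma rootedCount_extended_inr [Finite V] (K : SimpleGraph V) (m : ℕ) (i : Fin (m + 1)) :
    (K.extended (m + 1)).rootedCount (.inr i) = (K.extended m).moralCount := by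
  have h1 : (K.extended (m + 1)).outerCount (.inr i) = 1 :=
    outerCount_eq_one fun x hx => K.extended_adj_inr i hx
  suffices h : (K.extended (m + 1)).rootedCount (.inr i) =
      (K.extended m).moralCount * (K.extended (m + 1)).outerCount (.inr i) by
    rw [h, h1, Nat.mul_one]
  refine rootedCount_eq_mul (e := Sum.map id i.succAbove)
    (Function.Injective.sumMap Function.injective_id Fin.succAbove_right_injective) ?_ ?_
  · rintro (x | j)
    · simp
    · simp [eq_comm (a := i), ← Fin.exists_succAbove_eq_iff]
  · rintro (x | i) (y | j) <;> simp

lemma moralCount_extended_succ [Fintype V] (K : SimpleGraph V) (m : ℕ) :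
    (K.extended (m + 1)).moralCount =
      ∑ v, ((K.nbrGraph v).extended (m + 1)).moralCount * K.outerCount v +
        (m + 1) * (K.extended m).moralCount := by
  rw [moralCount_eq_sum_rootedCount (u := .inr 0) fun x hx => K.extended_adj_inr 0 hx,
    Fintype.sum_sum_type]
  simp [rootedCount_extended_inl, rootedCount_extended_inr]

lemma moralCount_extended_zero (K : SimpleGraph V) :
    (K.extended 0).moralCount = K.moralCount :=
  moralCount_congr (Equiv.sumEmpty V (Fin 0)) (by
    rintro (x | i) (y | j)
    · simp
    · exact j.elim0
    · exact i.elim0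
    · exact i.elim0)

lemma IsRootable.moralCount_pos [Finite V] {K : SimpleGraph V} (hK : K.IsRootable) :
    0 < K.moralCount := by
  have : Nonempty {R : V → V → Prop // K.IsMoralOrientation R} := by
    rcases isEmpty_or_nonempty V with hV | ⟨⟨v⟩⟩
    · exact ⟨⟨fun _ _ => False, fun x => isEmptyElim x, ⟨fun _ => 0, fun x => isEmptyElim x⟩,
        fun x => isEmptyElim x⟩⟩
    · obtain ⟨R, hR, -⟩ := hK.exists_isMoralOrientation v
      exact ⟨⟨R, hR⟩⟩
  exact Nat.card_pos

lemma IsRootable.sizeExtended_eq [Finite V] {K : SimpleGraph V} (hK : K.IsRootable) (m : ℕ) :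
    K.sizeExtended m = (K.extended m).moralCount :=
  (hK.extended m).size_eq

lemma IsRootable.sizeExtended_zero [Finite V] {K : SimpleGraph V} (hK : K.IsRootable) :
    K.sizeExtended 0 = K.size := by
  rw [hK.sizeExtended_eq, moralCount_extended_zero, hK.size_eq, moralCount]

lemma IsRootable.sizeIncrement_eq [Fintype V] {K : SimpleGraph V} (hK : K.IsRootable) (m : ℕ) :
    K.sizeIncrement m =
      ∑ v, ((K.nbrGraph v).sizeExtended m : ℚ) / m.factorial * K.outerCount v := by
  unfold sizeIncrement
  rw [Finset.mul_sum]
  refine Finset.sum_congr rfl fun v _ => ?_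
  have h1 : K.rootedSize v = K.rootedCount v := hK.rootedSize_eq v
  have h2 : (K.nbrGraph v).size = (K.nbrGraph v).moralCount := (hK.nbrGraph v).size_eq
  have h3 : ((K.nbrGraph v).moralCount : ℚ) ≠ 0 := by
    exact_mod_cast (hK.nbrGraph v).moralCount_pos.ne'
  rw [h1, h2, rootedCount_eq, Nat.cast_mul]
  field_simp

/-- Dividing by the factorial turns the recursion over roots into a first-order difference equation.
-/
lemma IsRootable.sizeExtended_succ_div [Fintype V] {K : SimpleGraph V} (hK : K.IsRootable)
    (m : ℕ) : (K.sizeExtended (m + 1) : ℚ) / (m + 1).factorial =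
      K.sizeExtended m / m.factorial + K.sizeIncrement (m + 1) := by
  rw [hK.sizeIncrement_eq, hK.sizeExtended_eq, hK.sizeExtended_eq, moralCount_extended_succ]
  have h : ∀ v, (K.nbrGraph v).sizeExtended (m + 1) =
      ((K.nbrGraph v).extended (m + 1)).moralCount :=
    fun v => (hK.nbrGraph v).sizeExtended_eq (m + 1)
  have hm : ((m + 1 : ℕ) : ℚ) ≠ 0 := by positivity
  simp only [h, Nat.factorial_succ]
  push_cast
  rw [add_div, Finset.sum_div, add_comm]
  congr 1
  · push_cast at hm
    field_simp
  · refine Finset.sum_congr rfl fun v _ => ?_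
    ring

end SimpleGraph

/-! ### Backward differences of polynomials. -/

namespace Polynomial

/-- Discrete antiderivatives of polynomials exist. -/
lemma exists_sub_comp_X_sub_one (n : ℕ) : ∀ P : ℚ[X], P.degree < n →
    ∃ Q : ℚ[X], Q.coeff 0 = 0 ∧ Q.degree < (n + 1 : ℕ) ∧ Q - Q.comp (X - 1) = P := by
  induction n with
  | zero =>
    intro P hP
    have : P = 0 := by simpa using hP
    exact ⟨0, by simp, by simp, by simp [this]⟩
  | succ n ih =>
    intro P hP
    have hn : ((n : ℚ) + 1) ≠ 0 := by positivity
    -- X^(n+1) - (X-1)^(n+1) has leading term (n+1) X^n, so `S` removes the coefficient of X^n from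
    -- `P`.
    let S : ℚ[X] := C (P.coeff n / (n + 1)) * X ^ (n + 1)
    have hS : ∀ k, n ≤ k → (S - S.comp (X - 1)).coeff k = P.coeff k := by
      intro k hk
      have hX : (X - 1 : ℚ[X]) = X + C (-1) := by simp [sub_eq_add_neg]
      have : (S - S.comp (X - 1)).coeff k = P.coeff n / (n + 1) *
          ((if k = n + 1 then 1 else 0) - (-1) ^ (n + 1 - k) * ((n + 1).choose k : ℚ)) := by
        rw [hX]
        simp only [S, mul_comp, C_comp, pow_comp, X_comp, coeff_sub, coeff_C_mul, coeff_X_pow,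
          coeff_X_add_C_pow]
        ring
      rw [this]
      rcases hk.eq_or_lt with rfl | hk
      · simp [Nat.choose_succ_self_right]
        field_simp
      · rw [coeff_eq_zero_of_degree_lt (p := P) (n := k) (hP.trans_le (by exact_mod_cast hk))]
        rcases (Nat.succ_le_of_lt hk).eq_or_lt with rfl | hk
        · simp
        · simp [Nat.choose_eq_zero_of_lt hk, hk.ne']
    obtain ⟨Q, hQ0, hQd, hQ⟩ := ih (P - (S - S.comp (X - 1))) (by
      rw [degree_lt_iff_coeff_zero]
      intro k hk
      rw [coeff_sub, hS k hk, sub_self])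
    refine ⟨Q + S, ?_, ?_, ?_⟩
    · simp [S, hQ0]
    · refine (degree_add_le _ _).trans_lt (max_lt (hQd.trans ?_) ?_)
      · exact_mod_cast Nat.lt_succ_self _
      · exact (degree_C_mul_X_pow_le _ _).trans_lt (by exact_mod_cast Nat.lt_succ_self _)
    · rw [add_comp]
      linear_combination hQ

/-- Binomial expansion of X^j - (X-1)^j; the index is shifted because `coeffA` counts rows from 1.
-/
lemma coeff_sub_comp_X_sub_one (Q : ℚ[X]) {n : ℕ} (hQ : Q.natDegree ≤ n) (k : ℕ) :
    (Q - Q.comp (X - 1)).coeff k =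
      ∑ j ∈ Finset.Icc (k + 1) n, coeffA (k + 1) j * Q.coeff j := by
  have hX : (X - 1 : ℚ[X]) = X + C (-1) := by simp [sub_eq_add_neg]
  have h1 : (Q - Q.comp (X - 1)).coeff k = ∑ j ∈ Finset.range (n + 1),
      Q.coeff j * ((if k = j then 1 else 0) - (-1) ^ (j - k) * (j.choose k : ℚ)) := by
    rw [hX, coeff_sub]
    conv_lhs => rw [comp_eq_sum_left, Q.as_sum_range' (n + 1) (by omega)]
    rw [← Q.as_sum_range' (n + 1) (by omega), sum_over_range' _ (by simp) (n + 1) (by omega)]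
    simp only [finsetSum_coeff, coeff_C_mul, coeff_X_add_C_pow, mul_sub, Finset.sum_sub_distrib]
    congr 1
    simp only [mul_ite, mul_one, mul_zero, Finset.sum_ite_eq, Finset.mem_range]
    split_ifs with h
    · rfl
    · exact coeff_eq_zero_of_natDegree_lt (by omega)
  rw [h1]
  symm
  refine Finset.sum_subset_zero_on_sdiff (fun j hj => ?_) (fun j hj => ?_) (fun j hj => ?_)
  · rw [Finset.mem_Icc] at hj
    rw [Finset.mem_range]
    omega
  -- For `j < k` the binomial coefficient vanishes; for `j = k` the leading terms cancel.
  · rw [Finset.mem_sdiff, Finset.mem_range, Finset.mem_Icc] at hj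
    rcases lt_trichotomy j k with h | rfl | h
    · simp [Nat.choose_eq_zero_of_lt h, h.ne']
    · simp
    · omega
  · rw [Finset.mem_Icc] at hj
    obtain ⟨i, rfl⟩ := Nat.exists_eq_add_of_le hj.1
    rw [coeffA, if_neg (by omega), show k + 1 + i - (k + 1) = i by omega,
      show k + 1 + i - k = i + 1 by omega, Nat.add_sub_cancel]
    ring

lemma exists_antidifference (P : ℚ[X]) : ∃ Q : ℚ[X], Q.coeff 0 = 0 ∧
    Q.natDegree ≤ P.natDegree + 1 ∧ Q - Q.comp (X - 1) = P := by
  obtain ⟨Q, h0, hd, hQ⟩ := exists_sub_comp_X_sub_one (P.natDegree + 1) P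
    (degree_le_natDegree.trans_lt (by exact_mod_cast Nat.lt_succ_self _))
  exact ⟨Q, h0, natDegree_le_iff_coeff_eq_zero.2
    fun k hk => (degree_lt_iff_coeff_zero _ _).1 hd k hk, hQ⟩

end Polynomial

/-! ### Polynomiality and the coefficients. -/

namespace SimpleGraph

open Polynomial

lemma IsRootable.sizeExtended_eq_eval {V : Type*} [Fintype V] {K : SimpleGraph V}
    (hK : K.IsRootable) {P Q : ℚ[X]} (hP : ∀ m : ℕ, K.sizeIncrement m = P.eval (m : ℚ))
    (hQ0 : Q.coeff 0 = 0) (hQ : Q - Q.comp (X - 1) = P) (m : ℕ) :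
    (K.sizeExtended m : ℚ) / m.factorial = K.size + Q.eval (m : ℚ) := by
  induction m with
  | zero => simp [hK.sizeExtended_zero, ← coeff_zero_eq_eval_zero, hQ0]
  | succ m ih =>
    rw [hK.sizeExtended_succ_div, ih, hP, ← hQ]
    simp [eval_comp]

lemma IsRootable.exists_sizeIncrement_eq_eval {V : Type*} [Fintype V] {K : SimpleGraph V}
    (hK : K.IsRootable) (h : ∀ v, ∃ F : ℚ[X], ∀ m : ℕ,
      ((K.nbrGraph v).sizeExtended m : ℚ) / m.factorial = F.eval (m : ℚ)) :
    ∃ P : ℚ[X], ∀ m : ℕ, K.sizeIncrement m = P.eval (m : ℚ) := by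
  choose F hF using h
  refine ⟨∑ v, F v * C (K.outerCount v : ℚ), fun m => ?_⟩
  simp [hK.sizeIncrement_eq, hF, eval_finsetSum]

/-- `f(K, m) / m!` is a polynomial in `m`. -/
lemma IsRootable.exists_sizeExtended_div_eq_eval (n : ℕ) :
    ∀ {V : Type*} [Fintype V] {K : SimpleGraph V}, K.IsRootable → Fintype.card V ≤ n →
    ∃ F : ℚ[X], ∀ m : ℕ, (K.sizeExtended m : ℚ) / m.factorial = F.eval (m : ℚ) := by
  classical
  induction n with
  | zero =>
    intro V _ K hK hn
    have : IsEmpty V := Fintype.card_eq_zero_iff.1 (Nat.le_zero.1 hn)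
    obtain ⟨P, hP⟩ := hK.exists_sizeIncrement_eq_eval fun v => isEmptyElim v
    obtain ⟨Q, hQ0, -, hQ⟩ := P.exists_antidifference
    exact ⟨C (K.size : ℚ) + Q, fun m => by simp [hK.sizeExtended_eq_eval hP hQ0 hQ]⟩
  | succ n ih =>
    intro V _ K hK hn
    -- The neighborhood of `v` omits `v`, so it has fewer vertices.
    obtain ⟨P, hP⟩ := hK.exists_sizeIncrement_eq_eval fun v => ih (hK.nbrGraph v) (by
      have : Fintype.card (K.neighborSet v) < Fintype.card V :=
        Fintype.card_subtype_lt (x := v) (by simp)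
      omega)
    obtain ⟨Q, hQ0, -, hQ⟩ := P.exists_antidifference
    exact ⟨C (K.size : ℚ) + Q, fun m => by simp [hK.sizeExtended_eq_eval hP hQ0 hQ]⟩

end SimpleGraph

theorem theorem2 {V : Type*} [Fintype V] (K : SimpleGraph V) (hK : K.IsChordal) :
    -- `g(K, m)` is a polynomial `P` in `m`, of degree `d = P.natDegree`, with `γ_i = P.coeff (i - 1)`
    ∃ P : Polynomial ℚ, (∀ m : ℕ, K.sizeIncrement m = P.eval (m : ℚ)) ∧
      ∃ β : ℕ → ℚ,
        β 0 = (K.size : ℚ) ∧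
        β (P.natDegree + 1) =
          P.coeff P.natDegree / coeffA (P.natDegree + 1) (P.natDegree + 1) ∧
        (∀ i ∈ Finset.Icc 1 P.natDegree,
          β i = (P.coeff (i - 1) -
            ∑ j ∈ Finset.Icc (i + 1) (P.natDegree + 1), coeffA i j * β j) / coeffA i i) ∧
        ∀ m : ℕ, (K.sizeExtended m : ℚ) =
          (β 0 + ∑ i ∈ Finset.Icc 1 (P.natDegree + 1), β i * (m : ℚ) ^ i) * (m.factorial : ℚ) := by
  classical
  have hR := hK.isRootable
  obtain ⟨P, hP⟩ := hR.exists_sizeIncrement_eq_eval fun v =>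
    (hR.nbrGraph v).exists_sizeExtended_div_eq_eval _ le_rfl
  obtain ⟨Q, hQ0, hQd, hQ⟩ := P.exists_antidifference
  -- The triangular system; its diagonal entry a_{ii} is `i`, hence nonzero.
  have hcoeff : ∀ i, 1 ≤ i → P.coeff (i - 1) =
      ∑ j ∈ Finset.Icc i (P.natDegree + 1), coeffA i j * Q.coeff j := by
    intro i hi
    obtain ⟨k, rfl⟩ := Nat.exists_eq_add_of_le' hi
    rw [Nat.add_sub_cancel, ← Q.coeff_sub_comp_X_sub_one hQd, hQ]
  have hA : ∀ i, 1 ≤ i → coeffA i i ≠ 0 := by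
    intro i hi
    have : i.choose (i - 1) ≠ 0 := (Nat.choose_pos (Nat.sub_le i 1)).ne'
    simpa [coeffA] using this
  -- The constant term is set separately, as `Q` vanishes at 0 and the difference equation
  -- determines h only up to a constant.
  obtain ⟨β, hβ0, hβ⟩ : ∃ β : ℕ → ℚ, β 0 = K.size ∧ ∀ i, 1 ≤ i → β i = Q.coeff i :=
    ⟨fun i => if i = 0 then K.size else Q.coeff i, by simp,
      fun i hi => if_neg (Nat.one_le_iff_ne_zero.1 hi)⟩
  refine ⟨P, hP, β, hβ0, ?_, ?_, ?_⟩
  · have h := hcoeff (P.natDegree + 1) (by omega)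
    rw [Finset.Icc_self, Finset.sum_singleton, Nat.add_sub_cancel] at h
    rw [hβ _ (by omega), h, mul_div_cancel_left₀ _ (hA _ (by omega))]
  · intro i hi
    rw [Finset.mem_Icc] at hi
    have hsum : ∑ j ∈ Finset.Icc (i + 1) (P.natDegree + 1), coeffA i j * β j =
        ∑ j ∈ Finset.Icc (i + 1) (P.natDegree + 1), coeffA i j * Q.coeff j := by
      refine Finset.sum_congr rfl fun j hj => ?_
      rw [Finset.mem_Icc] at hj
      rw [hβ j (by omega)]
    have h := hcoeff i hi.1
    rw [← Finset.add_sum_Ioc_eq_sum_Icc (by omega), ← Finset.Icc_add_one_left_eq_Ioc] at h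
    rw [hsum, h, hβ i hi.1, add_sub_cancel_right, mul_div_cancel_left₀ _ (hA i hi.1)]
  · intro m
    have h := hR.sizeExtended_eq_eval hP hQ0 hQ m
    rw [div_eq_iff (by positivity)] at h
    rw [h, hβ0, Polynomial.eval_eq_sum_range' (Nat.lt_succ_of_le hQd),
      Finset.sum_range_succ', hQ0, zero_mul, add_zero]
    congr 2
    refine Finset.sum_bij (fun j _ => j + 1) ?_ ?_ ?_ ?_
    · intro j hj
      rw [Finset.mem_range] at hj
      rw [Finset.mem_Icc]
      omega
    · intro a _ b _ hab
      omega
    · intro j hj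
      rw [Finset.mem_Icc] at hj
      exact ⟨j - 1, Finset.mem_range.2 (by omega), by omega⟩
    · intro j _
      rw [hβ _ (by omega)]
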